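/- For a finite set $E$ and a family $\mathcal{L}\subseteq 2^E$, the toggle $t_e:\mathcal{L}\to\mathcal{L}$ ($e\in E$) sends $X$ to $X\cup\{e\}$ if $e\notin X$ and $X\cup\{e\}\in\mathcal{L}$, to $X\setminus\{e\}$ if $e\in X$ and $X\setminus\{e\}\in\mathcal{L}$, and to $X$ otherwise. The toggle group $T(\mathcal{L})$ is the subgroup of the symmetric group $\mathfrak{S}_{\mathcal{L}}$ generated by the toggles, and $\mathcal{L}$ is called toggle-alternating if $T(\mathcal{L})$ contains the alternating group $A_{\mathcal{L}}$. For a finite poset $P$, let $\mathcal{IC}(P)\subseteq 2^P$ be the family of interval-closed sets, i.e. of those $I\subseteq P$ such that $x,y\in I$ and $x\le z\le y$ imply $z\in I$. An element $m\in P$ is extremal-atomic if it is maximal and covers only minimal elements, or is minimal and is covered only by maximal elements. Say that $P$ is strongly-extremal-atomic-free if there are $n\ge 0$ and elements $p_1,\dots,p_n$ of $P$ such that, with the induced subposets $P_0=P$ and $P_i=P_{i-1}\setminus\{p_i\}$, the poset $P_n$ is a chain with at least three elements, $p_{i+1}$ is a maximal or minimal element of $P_i$ for $0\le i\le n-1$,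 and each $P_i$ ($0\le i\le n$) has connected Hasse diagram and no extremal-atomic element. Let $P$ be a finite poset. 1. If $P$ is the disjoint union $P=P_1+P_2$ of two posets, then $T(\mathcal{IC}(P))\cong T(\mathcal{IC}(P_1))\times T(\mathcal{IC}(P_2))$, by an isomorphism that sends $t_p$ to $(t_p,1)$ for $p\in P_1$ and to $(1,t_p)$ for $p\in P_2$. 2. If $m\in P$ is extremal-atomic, then $T(\mathcal{IC}(P))\cong T(\mathcal{IC}(P\setminus\{m\}))\times T(\mathcal{IC}(\{m\}))\cong T(\mathcal{IC}(P\setminus\{m\}))\times\mathfrak{S}_2$, where the first isomorphism can be chosen to send $t_p$ to $(t_p,1)$ for $p\ne m$ and $t_m$ to $(1,t_m)$. 3. If $P$ has only two ranks, i.e. if there is a function $\rho:P\to\mathbb{Z}$ with at most two values and with $\rho(y)=\rho(x)+1$ whenever $y$ covers $x$, then $T(\mathcal{IC}(P))\cong(\mathfrak{S}_2)^{|P|}$. 4. If $P$ is strongly-extremal-atomic-free, then $\mathcal{IC}(P)$ is toggle-alternating. -/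

import Mathlib

universe u v w

section GeneralizedToggle

variable {E : Type u}

open Classical in
/-- The toggle of `e` relative to a family `L` of subsets of `E`, as a map on subsets: add `e` if
this gives a member of `L`, remove `e` if this gives a member of `L`, and do nothing otherwise. -/
noncomputable def toggleSet (L : Set (Set E)) (e : E) (X : Set E) : Set E :=
  if e ∉ X ∧ X ∪ {e} ∈ L then X ∪ {e}
  else if e ∈ X ∧ X \ {e} ∈ L then X \ {e}
  else X

theorem toggleSet_mem (L : Set (Set E)) (e : E) {X : Set E} (hX : X ∈ L) :
    toggleSet L e X ∈ L := by
  unfold toggleSet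
  split_ifs with h1 h2
  · exact h1.2
  · exact h2.2
  · exact hX

theorem toggleSet_toggleSet (L : Set (Set E)) (e : E) {X : Set E} (hX : X ∈ L) :
    toggleSet L e (toggleSet L e X) = X := by
  by_cases he : e ∈ X
  · by_cases h : X \ {e} ∈ L
    · have h1 : toggleSet L e X = X \ {e} := by simp [toggleSet, he, h]
      have h2 : X \ {e} ∪ {e} = X := by simpa using he
      rw [h1]
      unfold toggleSet
      rw [h2]
      simp [hX]
    · have h1 : toggleSet L e X = X := by simp [toggleSet, he, h]
      rw [h1, h1]
  · by_cases h : X ∪ {e} ∈ L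
    · have h1 : toggleSet L e X = X ∪ {e} := by
        unfold toggleSet
        rw [if_pos ⟨he, h⟩]
      have h2 : (X ∪ {e}) \ {e} = X := by
        ext x
        by_cases hx : x = e
        · subst hx; simp [he]
        · simp [hx]
      rw [h1]
      unfold toggleSet
      rw [h2]
      simp [hX]
    · have h1 : toggleSet L e X = X := by
        unfold toggleSet
        rw [if_neg (fun H => h H.2), if_neg (fun H => he H.1)]
      rw [h1, h1]

/-- The toggle `t_e : L → L`, an involutive permutation of the family `L`. -/
noncomputable def toggle (L : Set (Set E)) (e : E) : Equiv.Perm L where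
  toFun X := ⟨toggleSet L e X, toggleSet_mem L e X.2⟩
  invFun X := ⟨toggleSet L e X, toggleSet_mem L e X.2⟩
  left_inv X := Subtype.ext (toggleSet_toggleSet L e X.2)
  right_inv X := Subtype.ext (toggleSet_toggleSet L e X.2)

/-- The toggle group `T(L)`: the subgroup of the symmetric group on `L` generated by the toggles. -/
def toggleGroup (L : Set (Set E)) : Subgroup (Equiv.Perm L) :=
  Subgroup.closure (Set.range (toggle L))

/-- The toggle `t_e` as an element of the toggle group `T(L)`. -/
noncomputable def toggleGen (L : Set (Set E)) (e : E) : toggleGroup L :=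
  ⟨toggle L e, Subgroup.subset_closure (Set.mem_range_self e)⟩

open Classical in
/-- `L` is toggle-alternating if `T(L)` contains the alternating group on `L`. -/
def ToggleAlternating [Finite E] (L : Set (Set E)) : Prop :=
  letI : Fintype L := Fintype.ofFinite L
  alternatingGroup L ≤ toggleGroup L

end GeneralizedToggle

section IntervalClosed

/-- The interval-closed sets of a poset: if `x, y ∈ I` and `x ≤ z ≤ y` then `z ∈ I`. -/
def intervalClosedSets (P : Type u) [PartialOrder P] : Set (Set P) :=
  {I | I.OrdConnected}

variable {P : Type u} [PartialOrder P]

/-- `m` is maximal and covers only minimal elements, or `m` is minimal and is covered only by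
maximal elements. -/
def IsExtremalAtomic (m : P) : Prop :=
  (IsMax m ∧ ∀ x, x ⋖ m → IsMin x) ∨ (IsMin m ∧ ∀ x, m ⋖ x → IsMax x)

/-- The subposets `P_0 = P`, `P_{i+1} = P_i \ {p_{i+1}}`. The sequence is indexed from `0` here, so
`p i` is the element that is removed from `P_i`. -/
def remainingSubposet (p : ℕ → P) : ℕ → Set P
  | 0 => Set.univ
  | i + 1 => remainingSubposet p i \ {p i}

variable (P)

/-- One can remove from `P` elements `p 0, …, p (n - 1)`, each maximal or minimal in what remains,
so that a chain with at least three elements is left, and so that every poset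
`P_0, …, P_n` on the way has connected Hasse diagram and no extremal-atomic element.
(The values `p i` for `i ≥ n` play no role.) -/
def IsStronglyExtremalAtomicFree : Prop :=
  ∃ (n : ℕ) (p : ℕ → P),
    IsChain (· ≤ ·) (remainingSubposet p n) ∧
    3 ≤ (remainingSubposet p n).encard ∧
    (∀ i < n, Maximal (· ∈ remainingSubposet p i) (p i) ∨
      Minimal (· ∈ remainingSubposet p i) (p i)) ∧
    ∀ i ≤ n, (SimpleGraph.hasse (remainingSubposet p i)).Connected ∧
      ∀ m : remainingSubposet p i, ¬ IsExtremalAtomic m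

/-- `P` is graded, by a rank function that takes at most two values. -/
def HasOnlyTwoRanks : Prop :=
  ∃ ρ : P → ℤ, (∀ x y, x ⋖ y → ρ y = ρ x + 1) ∧ (Set.range ρ).encard ≤ 2

end IntervalClosed

/-! A family that splits along a partition of its ground set is a product on which each toggle moves
one coordinate, so its toggle group is a product. A disjoint union of posets splits this way. So
does `P` at an extremal-atomic `m`: interval-closure only constrains triples `x < z < y`, and `m`
lies in none. With two ranks there are no such triples, every subset is interval-closed, and the
toggles are independent commuting involutions.

For the last claim, the elements are put back one at a time, starting from the final chain. Let `p`
be extremal in `R` and at the end of a chain of three elements. Members of `IC(R)` avoiding `p` form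
`IC(R \ {p})`; those containing `p` are strictly fewer, since `I ↦ I \ {p}` injects them into `IC(R
\ {p})` but misses a singleton. The toggles other than `t_p` preserve both classes. By induction
they act on the larger one through at least the alternating group; simplicity and a count of orders
then give a 3-cycle fixing the smaller class pointwise. The toggle group is transitive and, because
the larger class is more than half of the family, primitive, so Jordan's theorem applies
(`alternatingGroup_le_of_isPretransitive`). Chains arise in the same way from the three-element
chain, whose seven interval-closed sets are treated directly. -/

/-! ### Permutation groups: a criterion for containing the alternating group -/

section PermutationGroups

open Equiv.Perm MulAction

variable {Γ : Type*} [Group Γ] {X Y Z : Type*}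

/-- If a group acts on `X` through at least the alternating group, and `Z` is smaller than `X`, then
every even permutation of `X` is realized by an element that acts trivially on `Z`. -/
theorem alternatingGroup_le_map_ker [Fintype X] [DecidableEq X] [Finite Z]
    (a : Γ →* Equiv.Perm X) (b : Γ →* Equiv.Perm Z) (hX : 5 ≤ Nat.card X)
    (hlt : Nat.card Z < Nat.card X) (ha : alternatingGroup X ≤ a.range) :
    alternatingGroup X ≤ b.ker.map a := by
  have hsimple := alternatingGroup.isSimpleGroup (α := X) hX
  have hnormal : ((b.ker.map a).subgroupOf (alternatingGroup X)).Normal := by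
    refine ⟨fun n hn g => ?_⟩
    rw [Subgroup.mem_subgroupOf] at hn ⊢
    obtain ⟨κ, hκ, hκn⟩ := hn
    obtain ⟨γ, hγ⟩ := ha g.2
    refine ⟨γ * κ * γ⁻¹, (inferInstance : b.ker.Normal).conj_mem κ hκ γ, ?_⟩
    simp [hγ, hκn]
  rcases hnormal.eq_bot_or_eq_top with hbot | htop
  -- If the intersection were trivial, choosing lifts to `Γ` and applying `b` would embed `A_X` in
  -- the permutations of `Z`, giving `|X|!/2 ≤ |Z|! ≤ (|X| - 1)!`, impossible for `|X| ≥ 5`.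
  · exfalso
    choose γ hγ using fun g : alternatingGroup X => ha g.2
    have hinj : Function.Injective fun g => b (γ g) := by
      intro g h hgh
      have hk : γ g * (γ h)⁻¹ ∈ b.ker := by
        rw [MonoidHom.mem_ker, map_mul, map_inv, mul_inv_eq_one]
        exact hgh
      have hm : g * h⁻¹ ∈ (b.ker.map a).subgroupOf (alternatingGroup X) := by
        rw [Subgroup.mem_subgroupOf]
        exact ⟨_, hk, by simp [hγ]⟩
      rw [hbot, Subgroup.mem_bot] at hm
      exact mul_inv_eq_one.mp hm
    have hcard := Nat.card_le_card_of_injective _ hinj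
    have : Nontrivial X := Finite.one_lt_card_iff_nontrivial.mp (by omega)
    have h2 := two_mul_nat_card_alternatingGroup (α := X)
    rw [Nat.card_perm] at h2 hcard
    obtain ⟨n, hn⟩ : ∃ n, Nat.card X = n + 1 := ⟨Nat.card X - 1, by omega⟩
    have h3 : (Nat.card Z).factorial ≤ n.factorial := Nat.factorial_le (by omega)
    rw [hn, Nat.factorial_succ] at h2
    nlinarith [Nat.factorial_pos n]
  · exact Subgroup.subgroupOf_eq_top.mp htop

/-- A subgroup that contains the alternating group on at least three letters is primitive. -/
theorem isPreprimitive_of_alternatingGroup_le [Fintype X] [DecidableEq X]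
    {H : Subgroup (Equiv.Perm X)} (hX : 3 ≤ Nat.card X) (hH : alternatingGroup X ≤ H) :
    IsPreprimitive H X := by
  have := alternatingGroup.isPreprimitive_of_three_le_card X hX
  let f : X →ₑ[Subgroup.inclusion hH] X := { toFun := id, map_smul' := fun _ _ => rfl }
  exact IsPreprimitive.of_surjective (f := f) Function.surjective_id

/-- A transitive group on `Y = X ∪ Z` contains the alternating group if it has elements that act on
`X` through at least the alternating group and preserve the smaller set `Z`. -/
theorem alternatingGroup_le_of_isPretransitive [Fintype X] [DecidableEq X] [Finite Z]
    [Fintype Y] [DecidableEq Y] (H : Subgroup (Equiv.Perm Y)) [IsPretransitive H Y]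
    (i : X → Y) (j : Z → Y) (hi : Function.Injective i)
    (hij : ∀ y, y ∈ Set.range i ∨ y ∈ Set.range j)
    (a : Γ →* Equiv.Perm X) (b : Γ →* Equiv.Perm Z) (c : Γ →* H)
    (hac : ∀ g x, (c g : Equiv.Perm Y) (i x) = i (a g x))
    (hbc : ∀ g z, (c g : Equiv.Perm Y) (j z) = j (b g z))
    (hX : 5 ≤ Nat.card X) (hlt : Nat.card Z < Nat.card X) (ha : alternatingGroup X ≤ a.range) :
    alternatingGroup Y ≤ H := by
  have hprim : IsPreprimitive H Y := by
    have h1 := isPreprimitive_of_alternatingGroup_le (by omega) ha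
    let _ : MulAction Γ X := MulAction.compHom X a
    let f : X →ₑ[a.rangeRestrict] X := { toFun := id, map_smul' := fun _ _ => rfl }
    have h2 : IsPreprimitive Γ X :=
      (isPreprimitive_congr (f := f) a.rangeRestrict_surjective Function.bijective_id).mpr h1
    let F : X →ₑ[c] Y := { toFun := i, map_smul' := fun g x => (hac g x).symm }
    -- The primitive `Γ`-set `X` fills more than half of the transitive set `Y`, because `|Y| ≤ |X|
    -- + |Z| < 2|X|`; this forces primitivity of `Y`.
    refine IsPreprimitive.of_card_lt (f := F) ?_
    have hr : (Set.range i).ncard = Nat.card X := by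
      rw [← Set.image_univ, Set.ncard_image_of_injective _ hi, Set.ncard_univ]
    have hs : (Set.range j).ncard ≤ Nat.card Z := by
      rw [← Set.image_univ, ← Set.ncard_univ]
      exact Set.ncard_image_le
    have hu : Nat.card Y ≤ (Set.range i).ncard + (Set.range j).ncard := by
      rw [← Set.ncard_univ, ← Set.eq_univ_of_forall (s := Set.range i ∪ Set.range j) hij]
      exact Set.ncard_union_le _ _
    change _ < 2 * (Set.range i).ncard
    omega
  have hker := alternatingGroup_le_map_ker a b hX hlt ha
  obtain ⟨x, y, z, hxy, hxz, hyz⟩ : ∃ x y z : X, x ≠ y ∧ x ≠ z ∧ y ≠ z := by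
    rw [← Fintype.two_lt_card_iff, ← Nat.card_eq_fintype_card]
    omega
  have h3 := isThreeCycle_swap_mul_swap_same hxy hxz hyz
  -- Lifting a 3-cycle of `X` inside the kernel of `b` makes it fix `Z`, so it remains a 3-cycle on
  -- `Y`.
  obtain ⟨g, hg, hga⟩ := hker h3.mem_alternatingGroup
  refine alternatingGroup_le_of_isPreprimitive_of_isThreeCycle_mem hprim
    (g := Equiv.swap (i x) (i y) * Equiv.swap (i x) (i z))
    (isThreeCycle_swap_mul_swap_same (hi.ne hxy) (hi.ne hxz) (hi.ne hyz)) ?_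
  convert (c g).2
  ext1 t
  by_cases ht : t ∈ Set.range i
  · obtain ⟨t, rfl⟩ := ht
    rw [hac, hga]
    simp [hi.swap_apply]
  · obtain ⟨s, rfl⟩ := (hij t).resolve_left ht
    have h1 : ∀ q, j s ≠ i q := fun q hq => ht ⟨q, hq.symm⟩
    rw [hbc, MonoidHom.mem_ker.mp hg]
    simp [Equiv.swap_apply_of_ne_of_ne, h1]

end PermutationGroups

/-! ### Evaluating toggles -/

section ToggleBasics

variable {E : Type*} {L : Set (Set E)}

theorem toggleSet_of_notMem {e : E} {X : Set E} (he : e ∉ X) (h : X ∪ {e} ∈ L) :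
    toggleSet L e X = X ∪ {e} := if_pos ⟨he, h⟩

theorem toggleSet_of_mem {e : E} {X : Set E} (he : e ∈ X) (h : X \ {e} ∈ L) :
    toggleSet L e X = X \ {e} := by
  rw [toggleSet, if_neg (fun H => H.1 he), if_pos ⟨he, h⟩]

theorem toggleSet_eq_self {e : E} {X : Set E} (h₁ : e ∉ X → X ∪ {e} ∉ L)
    (h₂ : e ∈ X → X \ {e} ∉ L) : toggleSet L e X = X := by
  rw [toggleSet, if_neg (fun H => h₁ H.1 H.2), if_neg (fun H => h₂ H.1 H.2)]

theorem toggle_mem_toggleGroup (e : E) : toggle L e ∈ toggleGroup L :=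
  Subgroup.subset_closure ⟨e, rfl⟩

end ToggleBasics

/-! ### Product families -/

section Product

variable {E : Type u} {E₁ : Type v} {E₂ : Type w} {L : Set (Set E)} {L₁ : Set (Set E₁)}
  {L₂ : Set (Set E₂)}

/-- A family that splits along a decomposition of the ground set is a product. -/
def familyProdEquiv (f : E₁ ⊕ E₂ ≃ E)
    (hL : ∀ X : Set E, X ∈ L ↔ (f ∘ Sum.inl) ⁻¹' X ∈ L₁ ∧ (f ∘ Sum.inr) ⁻¹' X ∈ L₂) :
    L ≃ L₁ × L₂ where
  toFun X := (⟨_, ((hL X).1 X.2).1⟩, ⟨_, ((hL X).1 X.2).2⟩)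
  invFun Y := ⟨(f ∘ Sum.inl) '' Y.1 ∪ (f ∘ Sum.inr) '' Y.2, by
    rw [hL]
    constructor
    · convert Y.1.2
      ext x
      simp
    · convert Y.2.2
      ext x
      simp⟩
  left_inv X := by
    ext x
    obtain ⟨y, rfl⟩ := f.surjective x
    rcases y with y | y <;> simp
  right_inv Y := by
    ext x <;> simp

open Classical in
theorem familyProdEquiv_toggle_inl (f : E₁ ⊕ E₂ ≃ E)
    (hL : ∀ X : Set E, X ∈ L ↔ (f ∘ Sum.inl) ⁻¹' X ∈ L₁ ∧ (f ∘ Sum.inr) ⁻¹' X ∈ L₂)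
    (p : E₁) (X : L) :
    familyProdEquiv f hL (toggle L (f (Sum.inl p)) X) =
      (toggle L₁ p (familyProdEquiv f hL X).1, (familyProdEquiv f hL X).2) := by
  have hX := (hL X).1 X.2
  have e1 : (f ∘ Sum.inl) ⁻¹' ((X : Set E) ∪ {f (Sum.inl p)}) = (f ∘ Sum.inl) ⁻¹' X ∪ {p} := by
    ext; simp
  have e2 : (f ∘ Sum.inr) ⁻¹' ((X : Set E) ∪ {f (Sum.inl p)}) = (f ∘ Sum.inr) ⁻¹' X := by
    ext; simp
  have e3 : (f ∘ Sum.inl) ⁻¹' ((X : Set E) \ {f (Sum.inl p)}) = (f ∘ Sum.inl) ⁻¹' X \ {p} := by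
    ext; simp
  have e4 : (f ∘ Sum.inr) ⁻¹' ((X : Set E) \ {f (Sum.inl p)}) = (f ∘ Sum.inr) ⁻¹' X := by
    ext; simp
  have h1 : (X : Set E) ∪ {f (Sum.inl p)} ∈ L ↔ (f ∘ Sum.inl) ⁻¹' X ∪ {p} ∈ L₁ := by
    rw [hL, e1, e2]; exact and_iff_left hX.2
  have h2 : (X : Set E) \ {f (Sum.inl p)} ∈ L ↔ (f ∘ Sum.inl) ⁻¹' X \ {p} ∈ L₁ := by
    rw [hL, e3, e4]; exact and_iff_left hX.2
  have h3 : f (Sum.inl p) ∈ (X : Set E) ↔ p ∈ (f ∘ Sum.inl) ⁻¹' (X : Set E) := Iff.rfl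
  refine Prod.ext (Subtype.ext ?_) (Subtype.ext ?_)
  · change (f ∘ Sum.inl) ⁻¹' (toggleSet L _ X) = toggleSet L₁ p ((f ∘ Sum.inl) ⁻¹' X)
    simp only [toggleSet, h1, h2, h3]
    split_ifs <;> simp only [e1, e3]
  · change (f ∘ Sum.inr) ⁻¹' (toggleSet L _ X) = (f ∘ Sum.inr) ⁻¹' X
    rw [toggleSet]
    split_ifs <;> simp only [e2, e4]

theorem familyProdEquiv_toggle_inr (f : E₁ ⊕ E₂ ≃ E)
    (hL : ∀ X : Set E, X ∈ L ↔ (f ∘ Sum.inl) ⁻¹' X ∈ L₁ ∧ (f ∘ Sum.inr) ⁻¹' X ∈ L₂)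
    (p : E₂) (X : L) :
    familyProdEquiv f hL (toggle L (f (Sum.inr p)) X) =
      ((familyProdEquiv f hL X).1, toggle L₂ p (familyProdEquiv f hL X).2) := by
  have h := familyProdEquiv_toggle_inl ((Equiv.sumComm E₂ E₁).trans f)
    (fun Y => (hL Y).trans and_comm) p X
  exact Prod.ext (congrArg Prod.snd h) (congrArg Prod.fst h)

/-- The action of a product of permutation groups on a product. -/
def permProdHom (α β : Type*) : Equiv.Perm α × Equiv.Perm β →* Equiv.Perm (α × β) where
  toFun g := Equiv.prodCongr g.1 g.2
  map_one' := rfl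
  map_mul' _ _ := rfl

/-- An empty factor would make the product empty and destroy faithfulness; this is why both families
must be nonempty below. -/
theorem permProdHom_injective (α β : Type*) [Nonempty α] [Nonempty β] :
    Function.Injective (permProdHom α β) := by
  intro g h hgh
  have key : ∀ x y, (g.1 x, g.2 y) = (h.1 x, h.2 y) := fun x y => DFunLike.congr_fun hgh (x, y)
  inhabit α
  inhabit β
  exact Prod.ext (Equiv.ext fun x => congrArg Prod.fst (key x default))
    (Equiv.ext fun y => congrArg Prod.snd (key default y))

/-- The toggle group of a family that splits along a decomposition of the ground set is the product
of the toggle groups of the two parts. -/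
theorem exists_toggleGroup_mulEquiv_prod (f : E₁ ⊕ E₂ ≃ E)
    (hL : ∀ X : Set E, X ∈ L ↔ (f ∘ Sum.inl) ⁻¹' X ∈ L₁ ∧ (f ∘ Sum.inr) ⁻¹' X ∈ L₂)
    (h₁ : L₁.Nonempty) (h₂ : L₂.Nonempty) :
    ∃ φ : toggleGroup L ≃* toggleGroup L₁ × toggleGroup L₂,
      (∀ p : E₁, φ (toggleGen L (f (Sum.inl p))) = (toggleGen L₁ p, 1)) ∧
      (∀ p : E₂, φ (toggleGen L (f (Sum.inr p))) = (1, toggleGen L₂ p)) := by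
  have := h₁.to_subtype
  have := h₂.to_subtype
  let ε := familyProdEquiv f hL
  let ψ : toggleGroup L₁ × toggleGroup L₂ →* Equiv.Perm L :=
    ε.symm.permCongrHom.toMonoidHom.comp
      ((permProdHom L₁ L₂).comp ((toggleGroup L₁).subtype.prodMap (toggleGroup L₂).subtype))
  have hψ : Function.Injective ψ :=
    ε.symm.permCongrHom.injective.comp ((permProdHom_injective L₁ L₂).comp
      (Function.Injective.prodMap Subtype.val_injective Subtype.val_injective))
  have hinl : ∀ p, ψ (toggleGen L₁ p, 1) = toggle L (f (Sum.inl p)) := by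
    intro p
    ext1 X
    change ε.symm (toggle L₁ p (ε X).1, (ε X).2) = _
    rw [Equiv.symm_apply_eq]
    exact (familyProdEquiv_toggle_inl f hL p X).symm
  have hinr : ∀ p, ψ (1, toggleGen L₂ p) = toggle L (f (Sum.inr p)) := by
    intro p
    ext1 X
    change ε.symm ((ε X).1, toggle L₂ p (ε X).2) = _
    rw [Equiv.symm_apply_eq]
    exact (familyProdEquiv_toggle_inr f hL p X).symm
  have hrange : ψ.range = toggleGroup L := by
    apply le_antisymm
    · rintro _ ⟨⟨⟨g, hg⟩, ⟨h, hh⟩⟩, rfl⟩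
      have hsplit : ψ (⟨g, hg⟩, ⟨h, hh⟩) = ψ (⟨g, hg⟩, 1) * ψ (1, ⟨h, hh⟩) := by
        rw [← map_mul]; simp
      rw [hsplit]
      apply mul_mem
      · have hle : (toggleGroup L₁) ≤ ((toggleGroup L).comap
            (ψ.comp (MonoidHom.inl _ _))).map (toggleGroup L₁).subtype := by
          refine (Subgroup.closure_le _).2 ?_
          rintro _ ⟨p, rfl⟩
          refine ⟨toggleGen L₁ p, ?_, rfl⟩
          change ψ _ ∈ toggleGroup L
          exact (hinl p).symm ▸ toggle_mem_toggleGroup _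
        obtain ⟨g', hg', rfl⟩ := hle hg
        exact hg'
      · have hle : (toggleGroup L₂) ≤ ((toggleGroup L).comap
            (ψ.comp (MonoidHom.inr _ _))).map (toggleGroup L₂).subtype := by
          refine (Subgroup.closure_le _).2 ?_
          rintro _ ⟨p, rfl⟩
          refine ⟨toggleGen L₂ p, ?_, rfl⟩
          change ψ _ ∈ toggleGroup L
          exact (hinr p).symm ▸ toggle_mem_toggleGroup _
        obtain ⟨h', hh', rfl⟩ := hle hh
        exact hh'
    · refine (Subgroup.closure_le _).2 ?_
      rintro _ ⟨e, rfl⟩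
      obtain ⟨p | p, rfl⟩ := f.surjective e
      · exact ⟨_, hinl p⟩
      · exact ⟨_, hinr p⟩
  let Φ := (MonoidHom.ofInjective hψ).trans (MulEquiv.subgroupCongr hrange)
  refine ⟨Φ.symm, fun p => ?_, fun p => ?_⟩
  · rw [MulEquiv.symm_apply_eq]
    exact Subtype.ext (hinl p).symm
  · rw [MulEquiv.symm_apply_eq]
    exact Subtype.ext (hinr p).symm

end Product

/-! ### The full power set -/

section Boolean

variable {E : Type*} [Finite E] {L : Set (Set E)}

/-- If every subset belongs to `L`, the toggle group is elementary abelian. -/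
theorem nonempty_toggleGroup_mulEquiv_pi (hL : ∀ X, X ∈ L) :
    Nonempty (toggleGroup L ≃* (E → Equiv.Perm (Fin 2))) := by
  classical
  have := Fintype.ofFinite E
  let ε : L ≃ (E → Fin 2) :=
    { toFun X e := if e ∈ (X : Set E) then 1 else 0
      invFun g := ⟨{e | g e = 1}, hL _⟩
      left_inv X := by ext e; simp
      right_inv g := by
        ext1 e
        by_cases h : g e = 1
        · simp [h]
        · simp only [Set.mem_ofPred_eq, if_neg h]
          omega }
  let π : (E → Equiv.Perm (Fin 2)) →* Equiv.Perm (E → Fin 2) :=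
    { toFun g := Equiv.piCongrRight g
      map_one' := rfl
      map_mul' _ _ := rfl }
  let ψ := ε.symm.permCongrHom.toMonoidHom.comp π
  have hψ : Function.Injective ψ := by
    refine ε.symm.permCongrHom.injective.comp fun g h hgh => ?_
    ext e t : 2
    exact congrFun (DFunLike.congr_fun hgh fun _ => t) e
  -- On indicator functions `t_e` flips the coordinate `e`, and these flips generate the whole
  -- product.
  have htog : ∀ e, ψ (Pi.mulSingle e (Equiv.swap 0 1)) = toggle L e := by
    intro e
    ext1 X
    change ε.symm (fun i => (Pi.mulSingle (M := fun _ => Equiv.Perm (Fin 2)) e (Equiv.swap 0 1)) i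
      (if i ∈ (X : Set E) then 1 else 0)) = _
    rw [Equiv.symm_apply_eq]
    ext1 i
    change _ = if i ∈ toggleSet L e X then (1 : Fin 2) else 0
    by_cases heX : e ∈ (X : Set E)
    · rw [toggleSet_of_mem heX (hL _)]
      by_cases hi : i = e
      · subst hi; simp [heX]
      · simp [hi]
    · rw [toggleSet_of_notMem heX (hL _)]
      by_cases hi : i = e
      · subst hi; simp [heX]
      · simp [hi]
  have hrange : ψ.range = toggleGroup L := by
    apply le_antisymm
    · rintro _ ⟨g, rfl⟩
      have hg : g ∈ (toggleGroup L).comap ψ := by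
        apply Subgroup.pi_mem_of_mulSingle_mem
        intro e
        have h2 : ∀ s : Equiv.Perm (Fin 2), s = 1 ∨ s = Equiv.swap 0 1 := by decide
        rcases h2 (g e) with h | h
        · rw [h, Pi.mulSingle_one]; exact one_mem _
        · rw [h, Subgroup.mem_comap, htog]; exact toggle_mem_toggleGroup e
      exact hg
    · refine (Subgroup.closure_le _).2 ?_
      rintro _ ⟨e, rfl⟩
      exact ⟨_, htog e⟩
  exact ⟨((MonoidHom.ofInjective hψ).trans (MulEquiv.subgroupCongr hrange)).symm⟩

end Boolean

/-! ### Transitivity and the induction step for general families -/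

section ToggleInduction

open MulAction

/-- The free group on the ground set serves as a common source acting on a family and on its
subfamilies at once; compatibility need only be checked on generators. -/
theorem freeGroup_equivariant {E X Y : Type*} (a : FreeGroup E →* Equiv.Perm X)
    (c : FreeGroup E →* Equiv.Perm Y) (i : X → Y)
    (h : ∀ e x, c (FreeGroup.of e) (i x) = i (a (FreeGroup.of e) x)) (g : FreeGroup E) (x : X) :
    c g (i x) = i (a g x) := by
  induction g using FreeGroup.induction_on generalizing x with
  | C1 => simp
  | of e => exact h e x
  | inv_of e _ =>
    rw [map_inv, map_inv, Equiv.Perm.inv_eq_iff_eq, h]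
    simp
  | mul g g' hg hg' => simp [hg, hg']

variable {E : Type*} {L : Set (Set E)}

theorem toggleSet_congr {L' : Set (Set E)} {e : E} {X : Set E} (h₁ : X ∪ {e} ∈ L ↔ X ∪ {e} ∈ L')
    (h₂ : X \ {e} ∈ L ↔ X \ {e} ∈ L') : toggleSet L e X = toggleSet L' e X := by
  classical
  unfold toggleSet
  exact if_congr (and_congr_right' h₁) rfl (if_congr (and_congr_right' h₂) rfl rfl)

theorem toggleSet_sep {Q : Set E → Prop} {e : E} {X : Set E} (h₁ : Q (X ∪ {e}))
    (h₂ : Q (X \ {e})) : toggleSet {Y | Y ∈ L ∧ Q Y} e X = toggleSet L e X :=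
  toggleSet_congr (and_iff_left h₁) (and_iff_left h₂)

/-- If every nonempty member of the family can be shrunk by one element, the toggle group is
transitive. -/
theorem isPretransitive_toggleGroup [Finite E] (hempty : ∅ ∈ L)
    (hL : ∀ X ∈ L, X.Nonempty → ∃ e ∈ X, X \ {e} ∈ L) : IsPretransitive (toggleGroup L) L := by
  have key : ∀ n, ∀ X : L, (X : Set E).ncard = n → ∃ g : toggleGroup L, g • ⟨∅, hempty⟩ = X := by
    intro n
    induction n with
    | zero =>
      intro X hX
      refine ⟨1, Subtype.ext ?_⟩
      simpa using ((Set.ncard_eq_zero).mp hX).symm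
    | succ n ih =>
      intro X hX
      obtain ⟨e, he, hXe⟩ := hL X X.2 (Set.nonempty_of_ncard_ne_zero (by omega))
      have h1 : toggle L e X = ⟨_, hXe⟩ := Subtype.ext (toggleSet_of_mem he hXe)
      obtain ⟨g, hg⟩ := ih ⟨_, hXe⟩ (by
        have := Set.ncard_sdiff_singleton_add_one he
        simp only
        omega)
      refine ⟨toggleGen L e * g, ?_⟩
      rw [mul_smul, hg, ← h1]
      exact Subtype.ext (toggleSet_toggleSet L e X.2)
  refine ⟨fun X Y => ?_⟩
  obtain ⟨g, hg⟩ := key _ X rfl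
  obtain ⟨h, hh⟩ := key _ Y rfl
  exact ⟨h * g⁻¹, by rw [mul_smul, ← hg, inv_smul_smul, hh]⟩

/-- If the members that avoid `e` form a toggle-alternating family and outnumber those that
contain `e`, and the toggle group is transitive, then the family is toggle-alternating. -/
theorem toggleAlternating_of_sep_notMem [Finite E] (e : E) [IsPretransitive (toggleGroup L) L]
    (h5 : 5 ≤ {X | X ∈ L ∧ e ∉ X}.ncard)
    (hlt : {X | X ∈ L ∧ e ∈ X}.ncard < {X | X ∈ L ∧ e ∉ X}.ncard)
    (halt : ToggleAlternating {X | X ∈ L ∧ e ∉ X}) : ToggleAlternating L := by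
  classical
  let _ : Fintype L := Fintype.ofFinite L
  let _ : Fintype {X | X ∈ L ∧ e ∉ X} := Fintype.ofFinite _
  let a := FreeGroup.lift (toggle {X | X ∈ L ∧ e ∉ X})
  let b := FreeGroup.lift (toggle {X | X ∈ L ∧ e ∈ X})
  -- The generator `e` goes to the identity: `t_e` relative to either subfamily is trivial, whereas
  -- `t_e` relative to `L` may exchange members of the two.
  let c : FreeGroup E →* toggleGroup L :=
    FreeGroup.lift fun q => if q = e then 1 else toggleGen L q
  refine alternatingGroup_le_of_isPretransitive (toggleGroup L) (Γ := FreeGroup E)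
    (X := {X | X ∈ L ∧ e ∉ X}) (Z := {X | X ∈ L ∧ e ∈ X}) (fun X => ⟨X, X.2.1⟩)
    (fun X => ⟨X, X.2.1⟩) (fun X Y h => Subtype.ext (congrArg Subtype.val h :)) ?_ a b c ?_ ?_
    h5 hlt ?_
  · intro X
    by_cases he : e ∈ (X : Set E)
    · exact Or.inr ⟨⟨X, X.2, he⟩, rfl⟩
    · exact Or.inl ⟨⟨X, X.2, he⟩, rfl⟩
  · refine freeGroup_equivariant a ((toggleGroup L).subtype.comp c) _ fun q X => ?_
    have hX := X.2.2
    apply Subtype.ext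
    by_cases hq : q = e
    · subst hq
      simp only [a, c, MonoidHom.comp_apply, FreeGroup.lift_apply_of, if_pos, map_one,
        Equiv.Perm.one_apply]
      exact (toggleSet_eq_self (fun _ h => h.2 (by simp)) (fun h => absurd h hX)).symm
    · simp only [a, c, MonoidHom.comp_apply, FreeGroup.lift_apply_of, if_neg hq]
      exact (toggleSet_sep (by simp [hX, Ne.symm hq]) (by simp [hX])).symm
  · refine freeGroup_equivariant b ((toggleGroup L).subtype.comp c) _ fun q X => ?_
    have hX := X.2.2
    apply Subtype.ext
    by_cases hq : q = e
    · subst hq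
      simp only [b, c, MonoidHom.comp_apply, FreeGroup.lift_apply_of, if_pos, map_one,
        Equiv.Perm.one_apply]
      exact (toggleSet_eq_self (fun h => absurd hX h) (fun _ h => h.2.2 rfl)).symm
    · simp only [b, c, MonoidHom.comp_apply, FreeGroup.lift_apply_of, if_neg hq]
      exact (toggleSet_sep (by simp [hX]) (by simp [hX, Ne.symm hq])).symm
  · rw [FreeGroup.range_lift_eq_closure]
    unfold ToggleAlternating toggleGroup at halt
    convert halt

end ToggleInduction

/-! ### Interval-closed sets of subposets and removal of an extremal element -/

section RelativeIntervalClosed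

variable {P : Type*} [PartialOrder P]

/-- The interval-closed sets of the subposet `R`, as subsets of the ambient poset. -/
def intervalClosedIn (R : Set P) : Set (Set P) :=
  {I | I ⊆ R ∧ ∀ x ∈ I, ∀ y ∈ I, ∀ z ∈ R, x ≤ z → z ≤ y → z ∈ I}

theorem intervalClosedIn_univ : intervalClosedIn (Set.univ : Set P) = intervalClosedSets P := by
  ext I
  exact ⟨fun h => ⟨fun x hx y hy z hz => h.2 x hx y hy z trivial hz.1 hz.2⟩,
    fun h => ⟨Set.subset_univ I, fun x hx y hy z _ h1 h2 => Set.OrdConnected.out h hx hy ⟨h1, h2⟩⟩⟩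

/-- Removing a maximal element of an interval-closed set leaves it interval-closed. -/
theorem isPretransitive_intervalClosedIn [Finite P] (R : Set P) :
    MulAction.IsPretransitive (toggleGroup (intervalClosedIn R)) (intervalClosedIn R) := by
  refine isPretransitive_toggleGroup ⟨Set.empty_subset _, by simp⟩ fun I hI hne => ?_
  obtain ⟨m, hm⟩ := I.toFinite.exists_maximal hne
  refine ⟨m, hm.prop, Set.sdiff_subset.trans hI.1, ?_⟩
  rintro x ⟨hx, _⟩ y ⟨hy, hym⟩ z hz hxz hzy
  refine ⟨hI.2 x hx y hy z hz hxz hzy, ?_⟩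
  rintro rfl
  exact hym (hm.eq_of_ge hy hzy)

/-- Since `p` is not strictly between two elements of `R`, its presence in the ground set puts no
condition on sets avoiding it. -/
theorem sep_notMem_intervalClosedIn {R : Set P} {p : P}
    (hp : ∀ x ∈ R, ∀ y ∈ R, x ≤ p → p ≤ y → x = p ∨ y = p) :
    {I | I ∈ intervalClosedIn R ∧ p ∉ I} = intervalClosedIn (R \ {p}) := by
  ext I
  constructor
  · rintro ⟨hI, hpI⟩
    refine ⟨fun x hx => ⟨hI.1 hx, ?_⟩, fun x hx y hy z hz => hI.2 x hx y hy z hz.1⟩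
    rintro rfl
    exact hpI hx
  · rintro hI
    have hpI : p ∉ I := fun h => (hI.1 h).2 rfl
    refine ⟨⟨fun x hx => (hI.1 hx).1, fun x hx y hy z hz hxz hzy => ?_⟩, hpI⟩
    by_cases hzp : z = p
    · subst hzp
      rcases hp x (hI.1 hx).1 y (hI.1 hy).1 hxz hzy with rfl | rfl <;> assumption
    · exact hI.2 x hx y hy z ⟨hz, hzp⟩ hxz hzy

/-- Adding to a subposet an element that is maximal or minimal and lies at the end of a chain of
three elements keeps the family of interval-closed sets toggle-alternating. -/
theorem toggleAlternating_intervalClosedIn_of_diff [Finite P] {R : Set P} {p : P} (hpR : p ∈ R)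
    (hp : ∀ x ∈ R, ∀ y ∈ R, x ≤ p → p ≤ y → x = p ∨ y = p)
    (hchain : ∃ x ∈ R, ∃ z ∈ R, x < z ∧ z < p ∨ p < z ∧ z < x)
    (h5 : 5 ≤ (intervalClosedIn (R \ {p})).ncard)
    (halt : ToggleAlternating (intervalClosedIn (R \ {p}))) :
    5 ≤ (intervalClosedIn R).ncard ∧ ToggleAlternating (intervalClosedIn R) := by
  have := isPretransitive_intervalClosedIn R
  have hsep := sep_notMem_intervalClosedIn hp
  rw [← hsep] at h5 halt
  refine ⟨h5.trans (Set.ncard_le_ncard fun I hI => hI.1),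
    toggleAlternating_of_sep_notMem p h5 ?_ halt⟩
  have hinj : Set.InjOn (fun I : Set P => I \ {p}) {I | I ∈ intervalClosedIn R ∧ p ∈ I} := by
    intro I hI J hJ h
    rw [← Set.insert_sdiff_self_of_mem hI.2, ← Set.insert_sdiff_self_of_mem hJ.2]
    exact congrArg (insert p) h
  rw [← hinj.ncard_image, hsep]
  refine Set.ncard_lt_ncard ?_ (Set.toFinite _)
  rw [Set.ssubset_iff_of_subset]
  · obtain ⟨x, hx, z, hz, h⟩ := hchain
    have hxp : x ≠ p := by rintro rfl; rcases h with h | h <;> exact lt_asymm h.1 h.2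
    have hzx : z ≠ x := by rcases h with h | h <;> [exact h.1.ne'; exact h.2.ne]
    have hzp : z ≠ p := by rcases h with h | h <;> [exact h.2.ne; exact h.1.ne']
    -- The singleton `{x}` is missed: an interval-closed set containing `x` and `p` also contains
    -- `z`.
    refine ⟨{x}, ⟨by simpa using ⟨hx, hxp⟩, ?_⟩, ?_⟩
    · rintro _ rfl _ rfl w _ h1 h2
      exact le_antisymm h2 h1
    · rintro ⟨I, ⟨hI, hpI⟩, hIx⟩
      have hxI : x ∈ I := (hIx.symm.subset rfl : x ∈ I \ {p}).1
      have hzI : z ∈ I := by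
        rcases h with h | h
        · exact hI.2 x hxI p hpI z hz h.1.le h.2.le
        · exact hI.2 p hpI x hxI z hz h.1.le h.2.le
      exact hzx (hIx.subset (⟨hzI, hzp⟩ : z ∈ I \ {p}))
  · rintro _ ⟨I, ⟨hI, hpI⟩, rfl⟩
    refine ⟨Set.sdiff_subset_sdiff_left hI.1, ?_⟩
    rintro x hx y hy z hz hxz hzy
    exact ⟨hI.2 x hx.1 y hy.1 z hz.1 hxz hzy, hz.2⟩

end RelativeIntervalClosed

/-! ### Chains with at least three elements -/

section Chains

variable {P : Type*} [PartialOrder P]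

/-- Of the eight subsets only `{a, c}` is excluded, whence seven members. -/
theorem mem_intervalClosedIn_three {a b c : P} (hab : a < b) (hbc : b < c) {I : Set P} :
    I ∈ intervalClosedIn {a, b, c} ↔ I ⊆ {a, b, c} ∧ (a ∈ I → c ∈ I → b ∈ I) := by
  refine and_congr_right fun hI => ⟨fun h ha hc => h a ha c hc b (by simp) hab.le hbc.le, ?_⟩
  rintro h x hx y hy z hz hxz hzy
  have hac := hab.trans hbc
  rcases hI hx with rfl | rfl | rfl <;> rcases hI hy with rfl | rfl | rfl <;>
    rcases hz with rfl | rfl | rfl <;> first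
      | assumption
      | exact h hx hy
      | exact absurd hxz (not_le_of_gt ‹_›)
      | exact absurd hzy (not_le_of_gt ‹_›)

open Classical in
theorem ncard_intervalClosedIn_three {a b c : P} (hab : a < b) (hbc : b < c) :
    (intervalClosedIn {a, b, c}).ncard = 7 := by
  have hac := hab.trans hbc
  let ε : intervalClosedIn {a, b, c} ≃
      {t : Bool × Bool × Bool // t.1 = true → t.2.2 = true → t.2.1 = true} :=
    { toFun I := ⟨(decide (a ∈ (I : Set P)), decide (b ∈ (I : Set P)), decide (c ∈ (I : Set P))), by
        simpa using ((mem_intervalClosedIn_three hab hbc).mp I.2).2⟩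
      invFun t := ⟨{x | x = a ∧ t.1.1 = true ∨ x = b ∧ t.1.2.1 = true ∨ x = c ∧ t.1.2.2 = true}, by
        rw [mem_intervalClosedIn_three hab hbc]
        refine ⟨?_, by simpa [hab.ne, hab.ne', hbc.ne, hbc.ne', hac.ne, hac.ne'] using t.2⟩
        rintro x (h | h | h) <;> simp [h.1]⟩
      left_inv I := by
        ext x
        simp only [decide_eq_true_eq]
        constructor
        · rintro (⟨rfl, h⟩ | ⟨rfl, h⟩ | ⟨rfl, h⟩) <;> exact h
        · intro hx
          rcases I.2.1 hx with rfl | rfl | rfl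
          · exact Or.inl ⟨rfl, hx⟩
          · exact Or.inr (Or.inl ⟨rfl, hx⟩)
          · exact Or.inr (Or.inr ⟨rfl, hx⟩)
      right_inv t := by
        simp [hab.ne, hab.ne', hbc.ne, hbc.ne', hac.ne, hac.ne'] }
  rw [← Nat.card_coe_set_eq, Nat.card_congr ε, Nat.card_eq_fintype_card]
  decide

theorem toggleAlternating_intervalClosedIn_three [Finite P] {a b c : P} (hab : a < b)
    (hbc : b < c) : ToggleAlternating (intervalClosedIn {a, b, c}) := by
  classical
  have hac := hab.trans hbc
  have := isPretransitive_intervalClosedIn {a, b, c}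
  let _ : Fintype (intervalClosedIn {a, b, c}) := Fintype.ofFinite _
  have hprim : MulAction.IsPreprimitive (toggleGroup (intervalClosedIn {a, b, c}))
      (intervalClosedIn {a, b, c}) := by
    -- Seven is prime, so transitivity already gives primitivity.
    apply MulAction.IsPreprimitive.of_prime_card
    rw [Nat.card_coe_set_eq, ncard_intervalClosedIn_three hab hbc]
    norm_num
  have mem : ∀ {I : Set P}, I ∈ intervalClosedIn {a, b, c} ↔
      I ⊆ {a, b, c} ∧ (a ∈ I → c ∈ I → b ∈ I) := mem_intervalClosedIn_three hab hbc
  have ne : a ≠ b ∧ b ≠ a ∧ a ≠ c ∧ c ≠ a ∧ b ≠ c ∧ c ≠ b :=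
    ⟨hab.ne, hab.ne', hac.ne, hac.ne', hbc.ne, hbc.ne'⟩
  obtain ⟨nab, nba, nac, nca, nbc, ncb⟩ := ne
  have hc : ({c} : Set P) ∈ intervalClosedIn {a, b, c} := mem.2 (by simp [nac])
  have hbc' : ({b, c} : Set P) ∈ intervalClosedIn {a, b, c} := mem.2 (by simp)
  have habc : ({a, b, c} : Set P) ∈ intervalClosedIn {a, b, c} := mem.2 (by simp)
  have h1 : (⟨_, hc⟩ : intervalClosedIn {a, b, c}) ≠ ⟨_, habc⟩ := fun h =>
    nac (((congrArg Subtype.val h :).symm.subset (by simp) : a ∈ ({c} : Set P)))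
  have h2 : (⟨_, hc⟩ : intervalClosedIn {a, b, c}) ≠ ⟨_, hbc'⟩ := fun h =>
    nbc (((congrArg Subtype.val h :).symm.subset (by simp) : b ∈ ({c} : Set P)))
  have h3 : (⟨_, habc⟩ : intervalClosedIn {a, b, c}) ≠ ⟨_, hbc'⟩ := fun h => by
    simpa [nab, nac] using ((congrArg Subtype.val h :).subset (by simp) : a ∈ ({b, c} : Set P))
  have hthree := Equiv.Perm.isThreeCycle_swap_mul_swap_same h2 h1 h3.symm
  refine Equiv.Perm.alternatingGroup_le_of_isPreprimitive_of_isThreeCycle_mem hprim hthree ?_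
  have add : ∀ (e : P) (I J : Set P), e ∉ I → J ∈ intervalClosedIn {a, b, c} → J = I ∪ {e} →
      toggleSet (intervalClosedIn {a, b, c}) e I = J := by
    rintro e I J he hJ rfl
    exact toggleSet_of_notMem he hJ
  have remove : ∀ (e : P) (I J : Set P), e ∉ I → I ∈ intervalClosedIn {a, b, c} → J = I ∪ {e} →
      toggleSet (intervalClosedIn {a, b, c}) e J = I := by
    rintro e I J he hI rfl
    have h : (I ∪ {e}) \ {e} = I := by simpa using he
    rw [toggleSet_of_mem (by simp) (h.symm ▸ hI), h]
  have hempty : (∅ : Set P) ∈ intervalClosedIn {a, b, c} := mem.2 (by simp)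
  have ha : ({a} : Set P) ∈ intervalClosedIn {a, b, c} := mem.2 (by simp [nca])
  have hb : ({b} : Set P) ∈ intervalClosedIn {a, b, c} := mem.2 (by simp)
  have hab' : ({a, b} : Set P) ∈ intervalClosedIn {a, b, c} :=
    mem.2 (by simp [Set.insert_subset_iff])
  let g : Set P → Set P := fun I =>
    toggleSet (intervalClosedIn {a, b, c}) a (toggleSet (intervalClosedIn {a, b, c}) b I)
  have g0 : g ∅ = {a, b} := by
    simp only [g]
    rw [add b ∅ {b} (by simp) hb (by simp), add a {b} {a, b} (by simp [nab]) hab' (by simp)]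
  have gab : g {a, b} = ∅ := by
    simp only [g]
    rw [remove b {a} {a, b} (by simp [nba]) ha (by simp [Set.pair_comm]),
      remove a ∅ {a} (by simp) hempty (by simp)]
  have ga : g {a} = {b} := by
    simp only [g]
    rw [add b {a} {a, b} (by simp [nba]) hab' (by simp [Set.pair_comm]),
      remove a {b} {a, b} (by simp [nab]) hb (by simp)]
  have gb : g {b} = {a} := by
    simp only [g]
    rw [remove b ∅ {b} (by simp) hempty (by simp), add a ∅ {a} (by simp) ha (by simp)]
  have gc : g {c} = {a, b, c} := by
    simp only [g]
    rw [add b {c} {b, c} (by simp [nbc]) hbc' (by simp),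
      add a {b, c} {a, b, c} (by simp [nab, nac]) habc (by simp)]
  have gbc : g {b, c} = {c} := by
    simp only [g]
    rw [remove b {c} {b, c} (by simp [nbc]) hc (by simp)]
    refine toggleSet_eq_self (fun _ h => ?_) (fun h => absurd h nac)
    simpa [nba, nbc] using (mem.1 h).2
  have gabc : g {a, b, c} = {b, c} := by
    have hb : toggleSet (intervalClosedIn {a, b, c}) b {a, b, c} = {a, b, c} := by
      refine toggleSet_eq_self (fun h => absurd (by simp) h) (fun _ h => ?_)
      simpa [nab, ncb] using (mem.1 h).2
    simp only [g]
    rw [hb, remove a {b, c} {a, b, c} (by simp [nab, nac]) hbc' (by simp)]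
  -- The product `t_a t_b` swaps `∅` with `{a, b}` and `{a}` with `{b}`, and rotates the three
  -- members containing `c`. Its fourth power kills the swaps and keeps the 3-cycle.
  have heq : Equiv.swap ⟨_, hc⟩ ⟨_, hbc'⟩ * Equiv.swap ⟨_, hc⟩ ⟨_, habc⟩ =
      (toggle (intervalClosedIn {a, b, c}) a * toggle (intervalClosedIn {a, b, c}) b) ^ 4 := by
    ext1 X
    apply Subtype.ext
    change _ = g (g (g (g X)))
    by_cases hcX : c ∈ (X : Set P)
    · have hX : X = ⟨_, hc⟩ ∨ X = ⟨_, hbc'⟩ ∨ X = ⟨_, habc⟩ := by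
        by_cases haX : a ∈ (X : Set P)
        · have hbX := (mem.1 X.2).2 haX hcX
          refine Or.inr (Or.inr (Subtype.ext (X.2.1.antisymm ?_)))
          simp [Set.insert_subset_iff, haX, hbX, hcX]
        · by_cases hbX : b ∈ (X : Set P)
          · refine Or.inr (Or.inl (Subtype.ext (Set.Subset.antisymm (fun x hx => ?_) ?_)))
            · exact (X.2.1 hx).resolve_left (by rintro rfl; exact haX hx)
            · simp [Set.insert_subset_iff, hbX, hcX]
          · refine Or.inl (Subtype.ext (Set.Subset.antisymm (fun x hx => ?_) ?_))
            · exact ((X.2.1 hx).resolve_left (by rintro rfl; exact haX hx)).resolve_left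
                (by rintro rfl; exact hbX hx)
            · simp [hcX]
      rw [Equiv.Perm.mul_apply]
      rcases hX with rfl | rfl | rfl
      · rw [Equiv.swap_apply_left, Equiv.swap_apply_of_ne_of_ne h1.symm h3]
        simp only [gc, gabc, gbc]
      · rw [Equiv.swap_apply_of_ne_of_ne h2.symm h3.symm, Equiv.swap_apply_right]
        simp only [gc, gabc, gbc]
      · rw [Equiv.swap_apply_right, Equiv.swap_apply_left]
        simp only [gc, gabc, gbc]
    · have hne : ∀ Y : intervalClosedIn {a, b, c}, c ∈ (Y : Set P) → X ≠ Y := by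
        rintro _ hY rfl
        exact hcX hY
      rw [Equiv.Perm.mul_apply, Equiv.swap_apply_of_ne_of_ne (hne _ (by simp)) (hne _ (by simp)),
        Equiv.swap_apply_of_ne_of_ne (hne _ (by simp)) (hne _ (by simp))]
      have hX : (X : Set P) ⊆ {a, b} := by
        intro x hx
        rcases X.2.1 hx with h | h | rfl
        · exact Or.inl h
        · exact Or.inr h
        · exact absurd hx hcX
      rcases Set.subset_pair_iff_eq.mp hX with h | h | h | h <;> simp only [h, g0, ga, gb, gab]
  rw [heq]
  exact pow_mem (mul_mem (toggle_mem_toggleGroup a) (toggle_mem_toggleGroup b)) 4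

/-- A nonempty finite chain has a strictly greatest element. -/
theorem IsChain.exists_forall_lt {R : Set P} (hR : IsChain (· ≤ ·) R) (hfin : R.Finite)
    (hne : R.Nonempty) : ∃ c ∈ R, ∀ x ∈ R, x ≠ c → x < c := by
  obtain ⟨c, hc⟩ := hfin.exists_maximal hne
  refine ⟨c, hc.prop, fun x hx hxc => lt_of_le_of_ne ?_ hxc⟩
  rcases hR.total hx hc.prop with h | h
  · exact h
  · exact hc.le_of_ge hx h

theorem toggleAlternating_intervalClosedIn_chain [Finite P] (n : ℕ) {R : Set P}
    (hR : IsChain (· ≤ ·) R) (hn : R.ncard = n + 3) :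
    5 ≤ (intervalClosedIn R).ncard ∧ ToggleAlternating (intervalClosedIn R) := by
  induction n generalizing R with
  | zero =>
    obtain ⟨x, y, z, hxy, hxz, hyz, rfl⟩ := Set.ncard_eq_three.mp hn
    obtain ⟨c, hc, hcmax⟩ := hR.exists_forall_lt (Set.toFinite _) ⟨x, by simp⟩
    have base : ∀ a b c : P, a < b → b < c → ({x, y, z} : Set P) = {a, b, c} →
        5 ≤ (intervalClosedIn {x, y, z}).ncard ∧
          ToggleAlternating (intervalClosedIn {x, y, z}) := by
      intro a b c hab hbc h
      rw [h, ncard_intervalClosedIn_three hab hbc]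
      exact ⟨by norm_num, toggleAlternating_intervalClosedIn_three hab hbc⟩
    have key : ∀ a b c : P, a ≠ b → a < c → b < c → ({x, y, z} : Set P) = {a, b, c} →
        5 ≤ (intervalClosedIn {x, y, z}).ncard ∧
          ToggleAlternating (intervalClosedIn {x, y, z}) := by
      intro a b c hab hac hbc h
      have ha : a ∈ ({x, y, z} : Set P) := by rw [h]; simp
      have hb : b ∈ ({x, y, z} : Set P) := by rw [h]; simp
      rcases hR.total ha hb with hle | hle
      · exact base a b c (lt_of_le_of_ne hle hab) hbc h
      · exact base b a c (lt_of_le_of_ne hle hab.symm) hac (h.trans (Set.insert_comm a b {c}))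
    rcases hc with rfl | rfl | rfl
    · refine key y z c hyz (hcmax y (by simp) hxy.symm) (hcmax z (by simp) hxz.symm) ?_
      rw [Set.insert_comm, Set.pair_comm]
    · refine key x z c hxz (hcmax x (by simp) hxy) (hcmax z (by simp) hyz.symm) ?_
      rw [Set.pair_comm]
    · exact key x y c hxy (hcmax x (by simp) hxz) (hcmax y (by simp) hyz) rfl
  | succ n ih =>
    obtain ⟨c, hc, hcmax⟩ := hR.exists_forall_lt R.toFinite
      (Set.nonempty_of_ncard_ne_zero (by omega))
    have h1 := Set.ncard_sdiff_singleton_add_one hc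
    have hR' : IsChain (· ≤ ·) (R \ {c}) := hR.mono Set.sdiff_subset
    obtain ⟨b, hb, hbmax⟩ := hR'.exists_forall_lt (Set.toFinite _)
      (Set.nonempty_of_ncard_ne_zero (by omega))
    have h2 := Set.ncard_sdiff_singleton_add_one hb
    obtain ⟨a, ha⟩ : ((R \ {c}) \ {b}).Nonempty := Set.nonempty_of_ncard_ne_zero (by omega)
    obtain ⟨h5, halt⟩ := ih hR' (by omega)
    refine toggleAlternating_intervalClosedIn_of_diff hc ?_
      ⟨a, ha.1.1, b, hb.1, Or.inl ⟨hbmax a ha.1 ha.2, hcmax b hb.1 hb.2⟩⟩ h5 halt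
    intro x _ y hy _ hcy
    by_contra! h
    exact (hcmax y hy h.2).not_ge hcy

end Chains

/-! ### Extremal-atomic elements, two ranks, and the descent to a chain -/

section ExtremalAtomic

variable {P : Type*} [PartialOrder P]

/-- In a finite poset, an extremal-atomic element lies in no chain of three elements. -/
theorem IsExtremalAtomic.ne_of_lt_of_lt [Finite P] {m x y z : P} (hm : IsExtremalAtomic m)
    (hxz : x < z) (hzy : z < y) : x ≠ m ∧ z ≠ m ∧ y ≠ m := by
  rcases hm with ⟨hmax, hcov⟩ | ⟨hmin, hcov⟩
  · refine ⟨?_, ?_, ?_⟩ <;> rintro rfl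
    · exact hmax.not_lt hxz
    · exact hmax.not_lt hzy
    · obtain ⟨t, hzt, hty⟩ := exists_le_covBy_of_lt hzy
      exact (hcov t hty).not_lt (hxz.trans_le hzt)
  · refine ⟨?_, ?_, ?_⟩ <;> rintro rfl
    · obtain ⟨t, hxt, htz⟩ := exists_covBy_le_of_lt hxz
      exact (hcov t hxt).not_lt (htz.trans_lt hzy)
    · exact hmin.not_lt hxz
    · exact hmin.not_lt (hxz.trans hzy)

theorem mem_intervalClosedSets_of_subsingleton [Subsingleton P] (X : Set P) :
    X ∈ intervalClosedSets P :=
  ⟨fun x hx _ _ z _ => Subsingleton.elim x z ▸ hx⟩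

theorem intervalClosedSets_nonempty : (intervalClosedSets P).Nonempty :=
  ⟨∅, Set.ordConnected_empty⟩

theorem IsExtremalAtomic.mem_intervalClosedSets_iff [Finite P] {m : P} (hm : IsExtremalAtomic m)
    (X : Set P) : X ∈ intervalClosedSets P ↔
      ((↑) ⁻¹' X : Set ({m}ᶜ : Set P)) ∈ intervalClosedSets ({m}ᶜ : Set P) ∧
        ((↑) ⁻¹' X : Set ({m} : Set P)) ∈ intervalClosedSets ({m} : Set P) := by
  refine ⟨fun h => ⟨⟨fun x hx y hy z hz => Set.OrdConnected.out h hx hy hz⟩,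
    mem_intervalClosedSets_of_subsingleton _⟩, fun h => ⟨fun x hx y hy z hz => ?_⟩⟩
  rcases hz.1.eq_or_lt with rfl | hxz
  · exact hx
  rcases hz.2.eq_or_lt with rfl | hzy
  · exact hy
  obtain ⟨hxm, hzm, hym⟩ := hm.ne_of_lt_of_lt hxz hzy
  exact Set.OrdConnected.out h.1 (x := ⟨x, hxm⟩) (y := ⟨y, hym⟩) hx hy
    (show (⟨z, hzm⟩ : ({m}ᶜ : Set P)) ∈ _ from hz)

theorem mem_intervalClosedSets_iff_of_orderIso {P₁ P₂ : Type*} [PartialOrder P₁] [PartialOrder P₂]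
    (f : P₁ ⊕ P₂ ≃o P) (X : Set P) : X ∈ intervalClosedSets P ↔
      (f ∘ Sum.inl) ⁻¹' X ∈ intervalClosedSets P₁ ∧
        (f ∘ Sum.inr) ⁻¹' X ∈ intervalClosedSets P₂ := by
  refine ⟨fun h => ⟨Set.OrdConnected.preimage_mono h (f.monotone.comp Sum.inl_mono),
    Set.OrdConnected.preimage_mono h (f.monotone.comp Sum.inr_mono)⟩,
    fun h => ⟨fun x hx y hy z hz => ?_⟩⟩
  obtain ⟨x, rfl⟩ := f.surjective x
  obtain ⟨y, rfl⟩ := f.surjective y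
  obtain ⟨z, rfl⟩ := f.surjective z
  rw [Set.mem_Icc, f.le_iff_le, f.le_iff_le] at hz
  rcases x with x | x <;> rcases y with y | y <;> rcases z with z | z <;> simp at hz
  · exact Set.OrdConnected.out h.1 hx hy hz
  · exact Set.OrdConnected.out h.2 hx hy hz

theorem HasOnlyTwoRanks.mem_intervalClosedSets [Finite P] (h : HasOnlyTwoRanks P) (X : Set P) :
    X ∈ intervalClosedSets P := by
  obtain ⟨ρ, hρ, hcard⟩ := h
  have hlt : ∀ x y : P, x < y → ρ x < ρ y := by
    intro x
    by_contra! hx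
    -- For a minimal counterexample `y`, an element `t ≥ x` covered by `y` is either `x` itself,
    -- contradicting the rank condition, or a smaller counterexample.
    obtain ⟨y, hy⟩ := (Set.toFinite {y | x < y ∧ ρ y ≤ ρ x}).exists_minimal hx
    obtain ⟨t, hxt, hty⟩ := exists_le_covBy_of_lt hy.prop.1
    have h1 := hρ t y hty
    have h2 := hy.prop.2
    rcases hxt.eq_or_lt with rfl | hxt
    · omega
    · exact (hy.le_of_le (y := t) ⟨hxt, by omega⟩ hty.le).not_gt hty.lt
  refine ⟨fun x hx y hy z hz => ?_⟩
  rcases hz.1.eq_or_lt with rfl | hxz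
  · exact hx
  rcases hz.2.eq_or_lt with rfl | hzy
  · exact hy
  have h1 := hlt x z hxz
  have h2 := hlt z y hzy
  have h3 : ({ρ x, ρ z, ρ y} : Set ℤ) ⊆ Set.range ρ := by
    simp [Set.insert_subset_iff]
  have h4 := (Set.encard_le_encard h3).trans hcard
  rw [Set.encard_eq_three.mpr ⟨ρ x, ρ z, ρ y, h1.ne, (h1.trans h2).ne, h2.ne, rfl⟩] at h4
  exact absurd h4 (by decide)

theorem toggleAlternating_of_isStronglyExtremalAtomicFree [Finite P]
    (h : IsStronglyExtremalAtomicFree P) : ToggleAlternating (intervalClosedSets P) := by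
  obtain ⟨n, p, hchain, hcard, hextremal, hfree⟩ := h
  suffices H : 5 ≤ (intervalClosedIn (remainingSubposet p 0)).ncard ∧
      ToggleAlternating (intervalClosedIn (remainingSubposet p 0)) by
    rw [← intervalClosedIn_univ]
    exact H.2
  refine Nat.decreasingInduction' (m := 0) (n := n) (P := fun i =>
    5 ≤ (intervalClosedIn (remainingSubposet p i)).ncard ∧
      ToggleAlternating (intervalClosedIn (remainingSubposet p i)))
    (fun i hi _ ih => ?_) (Nat.zero_le n) ?_
  · have hp := hextremal i hi
    have hpR : p i ∈ remainingSubposet p i := hp.elim (·.prop) (·.prop)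
    have hm := (hfree i hi.le).2 ⟨p i, hpR⟩
    refine toggleAlternating_intervalClosedIn_of_diff hpR ?_ ?_ ih.1 ih.2
    · intro x hx y hy hxp hpy
      rcases hp with hp | hp
      · exact Or.inr (hp.eq_of_ge hy hpy)
      · exact Or.inl (hp.eq_of_le hx hxp)
    -- As `p i` is extremal but not extremal-atomic, it covers a non-minimal element or is covered
    -- by a non-maximal one; this yields the chain of three elements.
    · rw [IsExtremalAtomic, not_or] at hm
      rcases hp with hp | hp
      · have hmax : IsMax (⟨p i, hpR⟩ : remainingSubposet p i) := fun y hy =>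
          hp.le_of_ge y.2 hy
        have h1 := hm.1
        push Not at h1
        obtain ⟨z, hz, hzmin⟩ := h1 hmax
        obtain ⟨x, hx⟩ := not_isMin_iff.mp hzmin
        exact ⟨x, x.2, z, z.2, Or.inl ⟨hx, hz.lt⟩⟩
      · have hmin : IsMin (⟨p i, hpR⟩ : remainingSubposet p i) := fun y hy =>
          hp.le_of_le y.2 hy
        have h1 := hm.2
        push Not at h1
        obtain ⟨z, hz, hzmax⟩ := h1 hmin
        obtain ⟨x, hx⟩ := not_isMax_iff.mp hzmax
        exact ⟨x, x.2, z, z.2, Or.inr ⟨hz.lt, hx⟩⟩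
  · rw [← (Set.toFinite _).cast_ncard_eq] at hcard
    have hcard' : 3 ≤ (remainingSubposet p n).ncard := by exact_mod_cast hcard
    exact toggleAlternating_intervalClosedIn_chain ((remainingSubposet p n).ncard - 3) hchain
      (by omega)

end ExtremalAtomic

theorem mainTheorem6 (P : Type u) [PartialOrder P] [Finite P] :
    -- disjoint unions: the isomorphism matches each toggle with the corresponding toggle
    (∀ (P₁ : Type v) (P₂ : Type w) [PartialOrder P₁] [PartialOrder P₂] (f : P₁ ⊕ P₂ ≃o P),
      ∃ φ : toggleGroup (intervalClosedSets P) ≃*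
          toggleGroup (intervalClosedSets P₁) × toggleGroup (intervalClosedSets P₂),
        (∀ p : P₁, φ (toggleGen _ (f (Sum.inl p))) = (toggleGen _ p, 1)) ∧
        (∀ p : P₂, φ (toggleGen _ (f (Sum.inr p))) = (1, toggleGen _ p))) ∧
    -- extremal-atomic elements
    (∀ m : P, IsExtremalAtomic m →
      (∃ φ : toggleGroup (intervalClosedSets P) ≃*
          toggleGroup (intervalClosedSets ({m}ᶜ : Set P)) ×
            toggleGroup (intervalClosedSets ({m} : Set P)),
        (∀ p : ({m}ᶜ : Set P), φ (toggleGen _ (p : P)) = (toggleGen _ p, 1)) ∧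
        (∀ p : ({m} : Set P), φ (toggleGen _ (p : P)) = (1, toggleGen _ p))) ∧
      Nonempty (toggleGroup (intervalClosedSets P) ≃*
        toggleGroup (intervalClosedSets ({m}ᶜ : Set P)) × Equiv.Perm (Fin 2))) ∧
    -- posets with only two ranks
    (HasOnlyTwoRanks P →
      Nonempty (toggleGroup (intervalClosedSets P) ≃* (P → Equiv.Perm (Fin 2)))) ∧
    -- strongly-extremal-atomic-free posets
    (IsStronglyExtremalAtomicFree P → ToggleAlternating (intervalClosedSets P)) := by
  classical
  refine ⟨fun P₁ P₂ _ _ f => ?_, fun m hm => ?_, fun h => ?_,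
    toggleAlternating_of_isStronglyExtremalAtomicFree⟩
  · exact exists_toggleGroup_mulEquiv_prod f.toEquiv (mem_intervalClosedSets_iff_of_orderIso f)
      intervalClosedSets_nonempty intervalClosedSets_nonempty
  -- `sumComm` puts the complement of `m` first. On the one-element factor every subset is
  -- interval-closed, which identifies its toggle group with `Equiv.Perm (Fin 2)`.
  · obtain ⟨φ, hφ⟩ := exists_toggleGroup_mulEquiv_prod
      ((Equiv.sumComm ({m}ᶜ : Set P) ({m} : Set P)).trans (Equiv.Set.sumCompl {m}))
      hm.mem_intervalClosedSets_iff intervalClosedSets_nonempty intervalClosedSets_nonempty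
    refine ⟨⟨φ, hφ⟩, ?_⟩
    obtain ⟨χ⟩ := nonempty_toggleGroup_mulEquiv_pi
      (mem_intervalClosedSets_of_subsingleton (P := ({m} : Set P)))
    exact ⟨φ.trans ((MulEquiv.refl _).prodCongr
      (χ.trans (MulEquiv.funUnique ({m} : Set P) (Equiv.Perm (Fin 2)))))⟩
  · exact nonempty_toggleGroup_mulEquiv_pi h.mem_intervalClosedSets
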